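/- Let $\mathbb{K}$ be a field, let $G$ be a finite simple graph with vertex set $\{v_1,\dots,v_n\}$, and let $I(G)\subseteq S=\mathbb{K}[x_1,\dots,x_n]$ be its edge ideal, that is, the ideal generated by the monomials $x_ix_j$ with $\{v_i,v_j\}$ an edge of $G$. For a nonzero monomial ideal $J\subseteq S$, a Stanley decomposition of $J$ is a decomposition $\mathcal{D}: J=\bigoplus_{i=1}^r u_i\mathbb{K}[Z_i]$ as a finite direct sum of $\mathbb{K}$-subspaces, where $u_i\in J$ is $\mathbb{Z}^n$-homogeneous (a scalar multiple of a monomial), $Z_i\subseteq\{x_1,\dots,x_n\}$, and $u_i\mathbb{K}[Z_i]$ is a free $\mathbb{K}[Z_i]$-module with basis $u_i$. Put ${\rm sdepth}(\mathcal{D})=\min_i |Z_i|$, and let the Stanley depth ${\rm sdepth}(J)$ be the maximum of ${\rm sdepth}(\mathcal{D})$ over all Stanley decompositions $\mathcal{D}$ of $J$. Let $p$ be the number of connected components of $G$ that are bipartite (an isolated vertex counts as a bipartite component), and suppose that at least one of the connected components of $G$ is a tree with at least one edge. Then for every integer $k\geq 1$, $${\rm sdepth}(I(G)^k)\geq p+1.$$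 -/

import Mathlib

/-- The edge ideal `I(G)` of a graph `G` on the vertex set `V`, in the polynomial ring over `K` with
one variable for each vertex: it is generated by the products `x_i x_j`, `{i, j}` an edge of `G`. -/
noncomputable def edgeIdeal (K : Type*) [Field K] {V : Type*} (G : SimpleGraph V) :
    Ideal (MvPolynomial V K) :=
  Ideal.span {f | ∃ i j : V, G.Adj i j ∧ f = MvPolynomial.X i * MvPolynomial.X j}

/-- The number of connected components of `G` that are bipartite graphs. (An isolated vertex is a
bipartite component.) -/
noncomputable def numBipartiteComponents {V : Type*} (G : SimpleGraph V) : ℕ :=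
  Nat.card {C : G.ConnectedComponent // C.toSimpleGraph.IsBipartite}

/-- An element of the polynomial ring is homogeneous for the fine (that is, `ℤⁿ`-) grading if it is a
scalar multiple of a monomial. The `ℤⁿ`-homogeneous elements of a monomial ideal are its elements of
this form. -/
def IsMultihomogeneous {K : Type*} [Field K] {V : Type*} (u : MvPolynomial V K) : Prop :=
  ∃ (a : V →₀ ℕ) (c : K), u = MvPolynomial.monomial a c

/-- The `K`-subspace `u K[Z] = {u v | v ∈ K[Z]}`, where `K[Z]` is the subalgebra of the polynomials
in the variables belonging to `Z`. -/
noncomputable def stanleySpace {K : Type*} [Field K] {V : Type*} (u : MvPolynomial V K)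
    (Z : Finset V) : Submodule K (MvPolynomial V K) :=
  (MvPolynomial.supported K (Z : Set V)).toSubmodule.map (LinearMap.mulLeft K u)

/-- A Stanley decomposition of a (monomial) ideal `J`: a finite family of Stanley spaces
`u_i K[Z_i]`, with `u_i` an `ℤⁿ`-homogeneous element, whose internal direct sum, as a `K`-vector space,
is `J`. -/
structure StanleyDecomposition {K : Type*} [Field K] {V : Type*}
    (J : Ideal (MvPolynomial V K)) where
  /-- the number of Stanley spaces -/
  r : ℕ
  u : Fin r → MvPolynomial V K
  Z : Fin r → Finset V
  homogeneous : ∀ i, IsMultihomogeneous (u i)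
  /-- `u_i K[Z_i]` is a free `K[Z_i]`-module, with basis `u_i` -/
  free : ∀ i, ∀ v ∈ MvPolynomial.supported K (Z i : Set V), u i * v = 0 → v = 0
  independent : iSupIndep fun i => stanleySpace (u i) (Z i)
  iSup_eq : ⨆ i, stanleySpace (u i) (Z i) = J.restrictScalars K

/-- The Stanley depth of a decomposition: the smallest dimension `|Z_i|` of its Stanley spaces
(`⊤` for the empty decomposition, which only the zero ideal has). -/
noncomputable def StanleyDecomposition.sdepth {K : Type*} [Field K] {V : Type*}
    {J : Ideal (MvPolynomial V K)} (D : StanleyDecomposition J) : ℕ∞ :=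
  ⨅ i, ((D.Z i).card : ℕ∞)

/-- The Stanley depth of a monomial ideal: the largest Stanley depth of its Stanley decompositions.
For a nonzero ideal in finitely many variables the values `D.sdepth` are bounded by the number of
variables, so the supremum is a maximum. -/
noncomputable def sdepth {K : Type*} [Field K] {V : Type*} (J : Ideal (MvPolynomial V K)) : ℕ∞ :=
  ⨆ D : StanleyDecomposition J, D.sdepth

/-! Stanley decompositions of a monomial ideal correspond to partitions of its exponent set into
cones, so the problem is combinatorial. Over disjoint sets of variables, cones multiply and their
free directions add (`StanleyPartition.inter`).

Let `A` and `B` be disjoint vertex sets with no edges between them. A monomial outside `I_A ^ k`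
lies in exactly one layer `I_A ^ i \ I_A ^ (i + 1)` with `i < k`, and there it belongs to `I_(A ∪ B)
^ k` iff its `B`-part lies in `I_B ^ (k - i)`. Hence the depth for the union is at least the smaller
of (layers of `A`) + (positive powers of `B`) and (powers of `A`) + `|B|`: this is
`edgePow.pow_union`.

Take for `B` the tree component and for `A` all the others. Each bipartite component adds one to the
depth of the layers of `A`: by a weighted König theorem (`edgePow.exists_cover`), a monomial outside
`I ^ (k + 1)` has a cover of weight at most `k`, and it stays outside along any vertex off the
cover. Positive powers for the tree have depth at least two, by induction on removing a leaf
(`edgePow.stanleyPartition_two`). As `A` has at least `p - 1` bipartite components, the total is `(p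
- 1) + 2`. -/

/-! ### Partitions of sets of exponent vectors into cones -/

section StanleyPartition

variable {V : Type*} [DecidableEq V]

/-- The exponent vectors of the monomials in the Stanley space `x^a K[Z]`. -/
def cone (a : V → ℕ) (Z : Finset V) : Set (V → ℕ) :=
  {m | ∀ v, a v ≤ m v ∧ (v ∉ Z → m v = a v)}

/-- `StanleyPartition A d U`: the set `U` of exponent vectors, which only depends on the coordinates
in `A`, is a finite disjoint union of cones that have at least `d` free directions in `A`. -/
inductive StanleyPartition (A : Finset V) (d : ℕ) : Set (V → ℕ) → Prop
  | empty : StanleyPartition A d ∅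
  | cone (a : V → ℕ) (Z : Finset V) (ha : ∀ v ∉ A, a v = 0) (hZ : ∀ v ∉ A, v ∈ Z)
      (hd : d ≤ (Z ∩ A).card) : StanleyPartition A d (cone a Z)
  | union {U W : Set (V → ℕ)} (hU : StanleyPartition A d U) (hW : StanleyPartition A d W)
      (hUW : Disjoint U W) : StanleyPartition A d (U ∪ W)

namespace StanleyPartition

variable {A B : Finset V} {d e : ℕ} {U W : Set (V → ℕ)}

theorem mono (h : StanleyPartition A d U) (hed : e ≤ d) : StanleyPartition A e U := by
  induction h with
  | empty => exact empty
  | cone a Z ha hZ hd => exact cone a Z ha hZ (hed.trans hd)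
  | union _ _ h ih₁ ih₂ => exact union ih₁ ih₂ h

theorem congr (h : StanleyPartition A d U) (hUW : ∀ m, m ∈ W ↔ m ∈ U) :
    StanleyPartition A d W := by
  rwa [Set.ext hUW]

theorem of_fibers {ι : Type*} [DecidableEq ι] (s : Finset ι) (F : ι → Set (V → ℕ))
    (hF : ∀ i ∈ s, StanleyPartition A d (F i))
    (huniq : ∀ m, ∀ i ∈ s, ∀ j ∈ s, m ∈ F i → m ∈ F j → i = j) :
    StanleyPartition A d {m | ∃ i ∈ s, m ∈ F i} := by
  induction s using Finset.induction_on with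
  | empty => exact empty.congr (by simp)
  | insert i s hi ih =>
    refine (union (hF i (Finset.mem_insert_self i s)) (ih (fun j hj => hF j (by simp [hj]))
      fun m j hj l hl => huniq m j (by simp [hj]) l (by simp [hl])) ?_).congr (by simp)
    rw [Set.disjoint_left]
    rintro m hm ⟨j, hj, hmj⟩
    have := huniq m i (by simp) j (by simp [hj]) hm hmj
    exact hi (this ▸ hj)

/-- Sets that depend only on `A`, respectively `B`, are cylinders, so their intersection is a
product: apexes add up, and a direction in `A` is automatically free for the cone over `B`. -/
theorem inter (hU : StanleyPartition A d U) (hW : StanleyPartition B e W) (hAB : Disjoint A B) :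
    StanleyPartition (A ∪ B) (d + e) (U ∩ W) := by
  induction hU with
  | empty => exact empty.congr (by simp)
  | union _ _ h ih₁ ih₂ =>
    rw [Set.union_inter_distrib_right]
    exact union ih₁ ih₂ (h.mono Set.inter_subset_left Set.inter_subset_left)
  | cone a Z ha hZ hd =>
    induction hW with
    | empty => exact empty.congr (by simp)
    | union _ _ h ih₁ ih₂ =>
      rw [Set.inter_union_distrib_left]
      exact union ih₁ ih₂ (h.mono Set.inter_subset_right Set.inter_subset_right)
    | cone b Y hb hY he =>
      refine (cone (a + b) (Z ∩ Y) ?_ ?_ ?_).congr fun m => ?_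
      · intro v hv
        simp only [Finset.mem_union, not_or] at hv
        simp [ha v hv.1, hb v hv.2]
      · intro v hv
        simp only [Finset.mem_union, not_or] at hv
        simp [hZ v hv.1, hY v hv.2]
      · have : (Z ∩ A) ∪ (Y ∩ B) ⊆ Z ∩ Y ∩ (A ∪ B) := by
          intro v hv
          simp only [Finset.mem_union, Finset.mem_inter] at hv ⊢
          rcases hv with ⟨h₁, h₂⟩ | ⟨h₁, h₂⟩
          · exact ⟨⟨h₁, hY v (Finset.disjoint_left.1 hAB h₂)⟩, .inl h₂⟩
          · exact ⟨⟨hZ v (Finset.disjoint_right.1 hAB h₂), h₁⟩, .inr h₂⟩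
        refine le_trans ?_ (Finset.card_le_card this)
        rw [Finset.card_union_of_disjoint
          (hAB.mono Finset.inter_subset_right Finset.inter_subset_right)]
        omega
      · simp only [Set.mem_inter_iff, _root_.cone, Set.mem_ofPred_eq, ← forall_and, Pi.add_apply,
          Finset.mem_inter, not_and_or]
        refine forall_congr' fun v => ?_
        by_cases hA : v ∈ A
        · have hB := Finset.disjoint_left.1 hAB hA
          simp only [hb v hB, hY v hB, not_true_eq_false, false_imp_iff, or_false,
            add_zero, zero_le, and_true]
        · simp only [ha v hA, hZ v hA, not_true_eq_false, false_imp_iff, false_or,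
            zero_add, zero_le, true_and]

/-- On each cone the coordinate `v` is either free, and the apex is raised to `c`, or constant, and
the cone is kept or dropped whole. -/
theorem inter_ge (h : StanleyPartition A d U) (v : V) (hv : v ∈ A) (c : ℕ) :
    StanleyPartition A d (U ∩ {m | c ≤ m v}) := by
  induction h with
  | empty => exact empty.congr (by simp)
  | union _ _ h ih₁ ih₂ =>
    rw [Set.union_inter_distrib_right]
    exact union ih₁ ih₂ (h.mono Set.inter_subset_left Set.inter_subset_left)
  | cone a Z ha hZ hd =>
    by_cases hvZ : v ∈ Z
    · refine (cone (Function.update a v (max (a v) c)) Z ?_ hZ hd).congr fun m => ?_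
      · intro w hw
        have : w ≠ v := fun h => hw (h ▸ hv)
        simp [this, ha w hw]
      · simp only [Set.mem_inter_iff, _root_.cone, Set.mem_ofPred_eq]
        constructor
        · rintro ⟨h, hc⟩ w
          rcases eq_or_ne w v with rfl | hw
          · simp [(h w).1, hc, hvZ]
          · simpa [hw] using h w
        · intro h
          have h1 := (h v).1
          simp only [Function.update_self, sup_le_iff] at h1
          refine ⟨fun w => ?_, h1.2⟩
          rcases eq_or_ne w v with rfl | hw
          · exact ⟨h1.1, fun h => absurd hvZ h⟩
          · simpa [hw] using h w
    · by_cases hc : c ≤ a v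
      · refine (cone a Z ha hZ hd).congr fun m => ?_
        simp only [Set.mem_inter_iff, and_iff_left_iff_imp]
        exact fun h => hc.trans (h v).1
      · refine empty.congr fun m => ?_
        simp only [Set.mem_inter_iff, Set.mem_empty_iff_false, iff_false, not_and]
        intro h h'
        have := (h v).2 hvZ
        simp only [Set.mem_ofPred_eq] at h'
        omega

theorem shift (h : StanleyPartition A d U) (v : V) (hv : v ∈ A) (c : ℕ) :
    StanleyPartition A d {m | c ≤ m v ∧ Function.update m v (m v - c) ∈ U} := by
  induction h with
  | empty => exact empty.congr (by simp)
  | union _ _ h ih₁ ih₂ =>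
    refine (union ih₁ ih₂ ?_).congr fun m => ?_
    · rw [Set.disjoint_left] at h ⊢
      exact fun m h₁ h₂ => h h₁.2 h₂.2
    · simp only [Set.mem_ofPred_eq, Set.mem_union]
      tauto
  | cone a Z ha hZ hd =>
    refine (cone (Function.update a v (a v + c)) Z ?_ hZ hd).congr fun m => ?_
    · intro w hw
      have : w ≠ v := fun h => hw (h ▸ hv)
      simp [this, ha w hw]
    · simp only [_root_.cone, Set.mem_ofPred_eq]
      constructor
      · rintro ⟨hc, h⟩ w
        have hw := h w
        rcases eq_or_ne w v with rfl | hwv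
        · simp only [Function.update_self] at hw ⊢
          exact ⟨by omega, fun h' => by have := hw.2 h'; omega⟩
        · simpa [hwv] using hw
      · intro h
        have h1 := (h v).1
        simp only [Function.update_self] at h1
        refine ⟨by omega, fun w => ?_⟩
        have hw := h w
        rcases eq_or_ne w v with rfl | hwv
        · simp only [Function.update_self] at hw ⊢
          exact ⟨by omega, fun h' => by have := hw.2 h'; omega⟩
        · simpa [hwv] using hw

variable [Fintype V]

theorem univ (A : Finset V) : StanleyPartition A A.card (Set.univ : Set (V → ℕ)) :=
  (cone 0 Finset.univ (by simp) (by simp) (by simp)).congr (by simp [_root_.cone])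

theorem setOf_eq (v : V) (c : ℕ) : StanleyPartition {v} 0 {m | m v = c} := by
  refine (cone (Pi.single v c) (Finset.univ.erase v) ?_ ?_ (by simp)).congr fun m => ?_
  · intro w hw
    simp only [Finset.mem_singleton] at hw
    simp [hw]
  · simp
  · simp only [_root_.cone, Set.mem_ofPred_eq]
    constructor
    · rintro rfl w
      rcases eq_or_ne w v with rfl | hw <;> simp [*]
    · intro h
      simpa using (h v).2

theorem setOf_ge (v : V) (c : ℕ) : StanleyPartition {v} 1 {m | c ≤ m v} := by
  have h := univ ({v} : Finset V)
  exact (h.inter_ge v (by simp) c).congr (by simp)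

end StanleyPartition

end StanleyPartition

/-! ### Finitely determined sets and their partitions -/

section Tame

/-- Membership in `U` only depends on the coordinates in `A`, truncated at `N`. -/
def Tame {V : Type*} (A : Finset V) (N : ℕ) (U : Set (V → ℕ)) : Prop :=
  ∀ m n : V → ℕ, (∀ v ∈ A, min (m v) N = min (n v) N) → m ∈ U → n ∈ U

namespace Tame

variable {V : Type*} {A B : Finset V} {N M : ℕ} {U W : Set (V → ℕ)}

theorem mem_iff (h : Tame A N U) {m n : V → ℕ} (hmn : ∀ v ∈ A, min (m v) N = min (n v) N) :
    m ∈ U ↔ n ∈ U :=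
  ⟨h m n hmn, h n m fun v hv => (hmn v hv).symm⟩

theorem compl (h : Tame A N U) : Tame A N Uᶜ :=
  fun _ _ hmn hm hn => hm ((h.mem_iff hmn).2 hn)

theorem inter (h : Tame A N U) (h' : Tame A N W) : Tame A N (U ∩ W) :=
  fun m n hmn hm => ⟨h m n hmn hm.1, h' m n hmn hm.2⟩

theorem mono (h : Tame A N U) (hNM : N ≤ M) : Tame A M U := by
  refine fun m n hmn => h m n fun v hv => ?_
  have := hmn v hv
  omega

variable [DecidableEq V]

theorem forall_add_single (h : Tame A N U) (v : V) :
    Tame A N {m | ∀ t, m + Pi.single v t ∈ U} := by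
  refine fun m n hmn hm t => h _ _ (fun w hw => ?_) (hm t)
  have := hmn w hw
  simp only [Pi.add_apply]
  omega

theorem update {v : V} (h : Tame (insert v A) N U) (c : ℕ) :
    Tame A N {m | Function.update m v c ∈ U} := by
  refine fun m n hmn => h _ _ fun w hw => ?_
  rcases eq_or_ne w v with rfl | hwv
  · simp
  · simpa [hwv] using hmn w (by simpa [hwv] using hw)

variable [Fintype V]

theorem stanleyPartition (h : Tame A N U) : StanleyPartition A 0 U := by
  induction A using Finset.induction_on generalizing U with
  | empty =>
    by_cases h0 : (0 : V → ℕ) ∈ U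
    · exact (StanleyPartition.univ ∅).congr fun m => by
        simpa using h _ _ (by simp) h0
    · exact StanleyPartition.empty.congr fun m => by
        simpa using fun hm => h0 (h _ _ (by simp) hm)
  | insert v A hv ih =>
    rw [Finset.insert_eq]
    -- Values below `N` of the coordinate `v` are separate fibres; all values from `N` on are
    -- indistinguishable and form a single ray.
    refine (StanleyPartition.of_fibers (Finset.range (N + 1))
      (fun c => (if c < N then {m | m v = c} else {m | c ≤ m v}) ∩
        {m | Function.update m v c ∈ U}) (fun c _ => ?_) ?_).congr fun m => ?_
    · rw [← add_zero 0]
      refine StanleyPartition.inter ?_ (ih (h.update c)) (by simpa using hv)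
      split_ifs
      · exact StanleyPartition.setOf_eq v c
      · exact (StanleyPartition.setOf_ge v c).mono zero_le_one
    · intro m i hi j hj hmi hmj
      simp only [Finset.mem_range] at hi hj
      have h1 := hmi.1
      have h2 := hmj.1
      split_ifs at h1 h2 <;> simp only [Set.mem_ofPred_eq] at h1 h2 <;> omega
    · have key : ∀ c, min (m v) N = min c N → (Function.update m v c ∈ U ↔ m ∈ U) := by
        intro c hc
        refine h.mem_iff fun w hw => ?_
        rcases eq_or_ne w v with rfl | hwv
        · simpa using hc.symm
        · simp [hwv]
      constructor
      · intro hm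
        refine ⟨min (m v) N, by simp, ?_, ?_⟩
        · split_ifs <;> simp only [Set.mem_ofPred_eq] <;> omega
        · exact (key _ (by simp)).2 hm
      · rintro ⟨c, hc, h1, h2⟩
        refine (key c ?_).1 h2
        simp only [Finset.mem_range] at hc
        split_ifs at h1 <;> simp only [Set.mem_ofPred_eq] at h1 <;> omega

/-- A set closed under increasing one coordinate splits into rays in this direction. -/
theorem stanleyPartition_one (h : Tame A N U) {v : V} (hv : v ∈ A)
    (hU : ∀ m ∈ U, m + Pi.single v 1 ∈ U) : StanleyPartition A 1 U := by
  obtain ⟨A, hvA, rfl⟩ : ∃ B : Finset V, v ∉ B ∧ A = insert v B :=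
    ⟨A.erase v, by simp, (Finset.insert_erase hv).symm⟩
  have step : ∀ (m : V → ℕ) c, Function.update m v c ∈ U → Function.update m v (c + 1) ∈ U := by
    intro m c hm
    convert hU _ hm using 1
    funext w
    rcases eq_or_ne w v with rfl | hwv <;> simp [*]
  have hmono : ∀ (m : V → ℕ) c c', c ≤ c' → Function.update m v c ∈ U →
      Function.update m v c' ∈ U := by
    intro m c c' hc hm
    induction c', hc using Nat.le_induction with
    | base => exact hm
    | succ c' _ ih => exact step m c' ih
  rw [Finset.insert_eq]
  -- The fibres are indexed by the least value of the coordinate `v` that puts the point into `U`;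
  -- tameness bounds it by `N`.
  refine (StanleyPartition.of_fibers (Finset.range (N + 1))
    (fun c => {m | c ≤ m v} ∩ ({m | Function.update m v c ∈ U} ∩
      {m | ∀ c' < c, Function.update m v c' ∉ U})) (fun c _ => ?_) ?_).congr fun m => ?_
  · refine StanleyPartition.inter (d := 1) (e := 0) (StanleyPartition.setOf_ge v c)
      (Tame.stanleyPartition (N := N) ((h.update c).inter ?_)) (by simpa using hvA)
    exact fun m n hmn hm c' hc' => (h.update c').compl m n hmn (hm c' hc')
  · intro m i _ j _ hmi hmj
    rcases lt_trichotomy i j with hij | hij | hij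
    · exact absurd hmi.2.1 (hmj.2.2 i hij)
    · exact hij
    · exact absurd hmj.2.1 (hmi.2.2 j hij)
  · constructor
    · intro hm
      have hN : Function.update m v (min (m v) N) ∈ U := by
        refine h m _ (fun w hw => ?_) hm
        rcases eq_or_ne w v with rfl | hwv <;> simp [*]
      classical
      have hex : ∃ c, Function.update m v c ∈ U := ⟨_, hN⟩
      have hle := Nat.find_min' hex hN
      refine ⟨Nat.find hex, ?_, ?_, Nat.find_spec hex, fun c' hc' => Nat.find_min hex hc'⟩
      · simp only [Finset.mem_range]
        omega
      · simp only [Set.mem_ofPred_eq]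
        omega
    · rintro ⟨c, -, h1, h2, -⟩
      simpa using hmono m c (m v) h1 h2

end Tame

variable {V : Type*} [DecidableEq V] [Fintype V] {A : Finset V} {N : ℕ} {P Q : Set (V → ℕ)}

/-- The elements of `P \ Q` are sorted by the first direction in which they stay outside `Q`. -/
theorem stanleyPartition_diff (hP : Tame A N P) (hQ : Tame A N Q) (hPu : IsUpperSet P)
    (hQu : IsUpperSet Q)
    (h : ∀ m ∈ P, m ∉ Q → ∃ v ∈ A, ∀ t, m + Pi.single v t ∉ Q) :
    StanleyPartition A 1 (P \ Q) := by
  -- `P` must vary: once the points that never enter `Q` along `v` are split off, the induction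
  -- continues with the rest of `P`, which is again an upper set because `Q` is.
  suffices H : ∀ S ⊆ A, ∀ P : Set (V → ℕ), Tame A N P → IsUpperSet P →
      StanleyPartition A 1 {m | m ∈ P ∧ ∃ v ∈ S, ∀ t, m + Pi.single v t ∉ Q} by
    refine (H A subset_rfl P hP hPu).congr fun m => ⟨fun hm => ⟨hm.1, h m hm.1 hm.2⟩, ?_⟩
    rintro ⟨hm, v, -, hv⟩
    exact ⟨hm, by simpa using hv 0⟩
  intro S hS
  induction S using Finset.induction_on with
  | empty => exact fun P _ _ => StanleyPartition.empty.congr (by simp)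
  | insert v S hvS ih =>
    intro P hP hPu
    have hF : Tame A N {m | ∀ t, m + Pi.single v t ∈ Qᶜ} := hQ.compl.forall_add_single v
    have hFu : IsUpperSet {m : V → ℕ | ∀ t, m + Pi.single v t ∈ Qᶜ}ᶜ := by
      intro m n hmn hm hn
      exact hm fun t hq => hn t (hQu (by gcongr) hq)
    refine ((Tame.stanleyPartition_one (hP.inter hF) (hS (Finset.mem_insert_self v S))
      ?_).union (ih ((Finset.subset_insert v S).trans hS) _ (hP.inter hF.compl)
        (hPu.inter hFu)) ?_).congr fun m => ?_
    · rintro m ⟨h1, h2⟩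
      refine ⟨hPu (by simp) h1, fun t => ?_⟩
      rw [add_assoc, ← Pi.single_add]
      exact h2 (1 + t)
    · rw [Set.disjoint_left]
      exact fun m h1 h2 => h2.1.2 h1.2
    · simp only [Finset.mem_insert, exists_eq_or_imp, Set.mem_union, Set.mem_inter_iff,
        Set.mem_ofPred_eq, Set.mem_compl_iff]
      tauto

end Tame

/-! ### Monomials in powers of edge ideals -/

section EdgePow

variable {V : Type*} [DecidableEq V]

/-- The exponent vectors of the monomials in the `k`-th power of the edge ideal of the subgraph of
`G` induced on `A`. -/
def edgePow (G : SimpleGraph V) (A : Finset V) : ℕ → Set (V → ℕ)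
  | 0 => Set.univ
  | k + 1 => {m | ∃ i ∈ A, ∃ j ∈ A, G.Adj i j ∧
      ∃ m' ∈ edgePow G A k, m = m' + Pi.single i 1 + Pi.single j 1}

namespace edgePow

variable {G : SimpleGraph V} {A B : Finset V} {k l : ℕ} {m n : V → ℕ} {x y v : V}

theorem add_edge (hm : m ∈ edgePow G A k) (hx : x ∈ A) (hy : y ∈ A) (h : G.Adj x y) :
    m + Pi.single x 1 + Pi.single y 1 ∈ edgePow G A (k + 1) :=
  ⟨x, hx, y, hy, h, m, hm, rfl⟩

theorem of_le_on (hmn : ∀ v ∈ A, m v ≤ n v) (hm : m ∈ edgePow G A k) : n ∈ edgePow G A k := by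
  induction k generalizing m n with
  | zero => trivial
  | succ k ih =>
    obtain ⟨i, hi, j, hj, hij, m', hm', rfl⟩ := hm
    refine ⟨i, hi, j, hj, hij, n - Pi.single i 1 - Pi.single j 1, ih (fun v hv => ?_) hm', ?_⟩
    · have := hmn v hv
      simp only [Pi.add_apply, Pi.sub_apply] at this ⊢
      omega
    · funext v
      have hne := hij.ne
      have hi' := hmn i hi
      have hj' := hmn j hj
      simp only [Pi.add_apply, Pi.sub_apply, Pi.single_apply] at hi' hj' ⊢
      split_ifs <;> simp_all <;> omega

theorem of_le (hmn : m ≤ n) (hm : m ∈ edgePow G A k) : n ∈ edgePow G A k :=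
  of_le_on (fun v _ => hmn v) hm

theorem isUpperSet : IsUpperSet (edgePow G A k) := fun _ _ => of_le

theorem congr_on (hmn : ∀ v ∈ A, m v = n v) : m ∈ edgePow G A k ↔ n ∈ edgePow G A k :=
  ⟨of_le_on fun v hv => (hmn v hv).le, of_le_on fun v hv => (hmn v hv).ge⟩

theorem of_succ (hm : m ∈ edgePow G A (k + 1)) : m ∈ edgePow G A k := by
  induction k generalizing m with
  | zero => trivial
  | succ k ih =>
    obtain ⟨i, hi, j, hj, hij, m', hm', rfl⟩ := hm
    exact add_edge (ih hm') hi hj hij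

theorem antitone : Antitone (edgePow G A) := antitone_nat_of_succ_le fun _ _ => of_succ

theorem mono (hAB : A ⊆ B) : edgePow G A k ⊆ edgePow G B k := by
  induction k with
  | zero => exact subset_rfl
  | succ k ih =>
    rintro _ ⟨i, hi, j, hj, hij, m', hm', rfl⟩
    exact add_edge (ih hm') (hAB hi) (hAB hj) hij

-- The bound `2 * k` is crude: each of the `k` edges is allowed to contribute two to a coordinate.
theorem tame : Tame A (2 * k) (edgePow G A k) := by
  have h : ∀ m ∈ edgePow G A k, (fun v => min (m v) (2 * k)) ∈ edgePow G A k := by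
    induction k with
    | zero => exact fun m _ => trivial
    | succ k ih =>
      rintro _ ⟨i, hi, j, hj, hij, m', hm', rfl⟩
      refine of_le (fun v => ?_) (add_edge (ih m' hm') hi hj hij)
      simp only [Pi.add_apply, Pi.single_apply]
      split_ifs <;> omega
  refine fun m n hmn hm => of_le_on (fun v hv => ?_) (h m hm)
  have := hmn v hv
  omega

/-- Either some `k` edges below `m` avoid `x`, or one of them meets `x`. -/
theorem erase_or (x : V) (hm : m ∈ edgePow G A k) :
    m ∈ edgePow G (A.erase x) k ∨ ∃ y ∈ A, G.Adj x y ∧ ∃ l, k = l + 1 ∧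
      ∃ m' ∈ edgePow G A l, m = m' + Pi.single x 1 + Pi.single y 1 := by
  induction k generalizing m with
  | zero => exact .inl trivial
  | succ k ih =>
    obtain ⟨i, hi, j, hj, hij, m', hm', rfl⟩ := hm
    by_cases hix : i = x
    · subst hix
      exact .inr ⟨j, hj, hij, k, rfl, m', hm', rfl⟩
    by_cases hjx : j = x
    · subst hjx
      exact .inr ⟨i, hi, hij.symm, k, rfl, m', hm', add_right_comm _ _ _⟩
    rcases ih hm' with h | ⟨y, hy, hxy, l, rfl, n, hn, rfl⟩
    · exact .inl (add_edge h (by simp [hi, hix]) (by simp [hj, hjx]) hij)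
    · exact .inr ⟨y, hy, hxy, l + 1, rfl, _, add_edge hn hi hj hij, by abel⟩

/-- Removing one factor `x_v` destroys at most one of the chosen edges. -/
theorem of_add_single (hm : m + Pi.single v 1 ∈ edgePow G A (k + 1)) : m ∈ edgePow G A k := by
  rcases erase_or v hm with h | ⟨y, -, -, l, hl, m', hm', h⟩
  · refine of_succ (mono (Finset.erase_subset v A) ((congr_on fun w hw => ?_).1 h))
    simp [Finset.ne_of_mem_erase hw]
  · obtain rfl : k = l := by omega
    have : m = m' + Pi.single y 1 := by
      rw [add_right_comm] at h
      exact add_right_cancel h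
    exact of_le (by simp [this]) hm'

theorem erase_of_eq_zero (hv : m v = 0) :
    m ∈ edgePow G A k ↔ m ∈ edgePow G (A.erase v) k := by
  refine ⟨fun hm => (erase_or v hm).resolve_right ?_, fun h => mono (Finset.erase_subset v A) h⟩
  rintro ⟨y, -, -, l, -, m', -, rfl⟩
  simp at hv

theorem erase_of_isolated (hv : ∀ y ∈ A, ¬ G.Adj v y) :
    m ∈ edgePow G A k ↔ m ∈ edgePow G (A.erase v) k := by
  refine ⟨fun hm => (erase_or v hm).resolve_right ?_, fun h => mono (Finset.erase_subset v A) h⟩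
  rintro ⟨y, hy, h, -⟩
  exact hv y hy h

theorem eq_empty (hA : ∀ i ∈ A, ∀ j ∈ A, ¬ G.Adj i j) (hk : 1 ≤ k) : edgePow G A k = ∅ := by
  obtain ⟨k, rfl⟩ := Nat.exists_eq_add_of_le' hk
  rw [Set.eq_empty_iff_forall_notMem]
  rintro _ ⟨i, hi, j, hj, hij, -⟩
  exact hA i hi j hj hij

section Leaf

variable (hx : x ∈ A) (hy : y ∈ A) (hxy : G.Adj x y) (hleaf : ∀ z ∈ A, G.Adj x z → z = y)

include hx hy hxy hleaf

/-- If the chosen edges avoid the leaf `x`, only the factor `y` is lost, costing at most one edge;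
otherwise one of them is `xy` itself and cancels. -/
theorem leaf_iff : m + Pi.single x 1 + Pi.single y 1 ∈ edgePow G A (k + 1) ↔
    m ∈ edgePow G A k := by
  refine ⟨fun h => ?_, fun h => add_edge h hx hy hxy⟩
  rcases erase_or x h with h | ⟨z, hz, hxz, l, hl, m', hm', h⟩
  · refine mono (Finset.erase_subset x A) (of_add_single (v := y) ((congr_on fun w hw => ?_).1 h))
    simp [Finset.ne_of_mem_erase hw]
  · obtain rfl := hleaf z hz hxz
    obtain rfl : k = l := by omega
    rwa [add_right_cancel (add_right_cancel h)]

theorem leaf_iff_add {t : ℕ} (ht : t ≤ k) :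
    m + Pi.single x t + Pi.single y t ∈ edgePow G A k ↔ m ∈ edgePow G A (k - t) := by
  induction t generalizing m k with
  | zero => simp
  | succ t ih =>
    obtain ⟨k, rfl⟩ := Nat.exists_eq_add_of_le' (Nat.one_le_of_lt ht)
    rw [Pi.single_add, Pi.single_add,
      show m + (Pi.single x t + Pi.single x 1) + (Pi.single y t + Pi.single y 1) =
        (m + Pi.single x t + Pi.single y t) + Pi.single x 1 + Pi.single y 1 by abel,
      leaf_iff hx hy hxy hleaf, ih (by omega)]
    congr! 2
    omega

/-- Cancelling `xy` as often as possible exhausts `y`; without `y` the leaf `x` is isolated, so both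
vertices can be deleted. -/
theorem leaf_ge (hmk : m y ≤ k) (hmx : m y ≤ m x) :
    m ∈ edgePow G A k ↔ m ∈ edgePow G ((A.erase y).erase x) (k - m y) := by
  have hne := hxy.ne
  set n := m - Pi.single x (m y) - Pi.single y (m y) with hn
  have hmn : m = n + Pi.single x (m y) + Pi.single y (m y) := by
    funext w
    simp only [hn, Pi.add_apply, Pi.sub_apply, Pi.single_apply]
    split_ifs <;> simp_all
  conv_lhs => rw [hmn]
  rw [leaf_iff_add hx hy hxy hleaf hmk, erase_of_eq_zero (v := y) (by simp [hn]),
    erase_of_isolated (v := x)]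
  · refine congr_on fun w hw => ?_
    simp only [Finset.mem_erase] at hw
    simp [hn, hw.1, hw.2.1]
  · intro z hz h
    exact Finset.ne_of_mem_erase hz (hleaf z (Finset.mem_of_mem_erase hz) h)

/-- Here the cancellation exhausts `x` first, and `y` survives with the difference of the exponents.
-/
theorem leaf_le (hmk : m x ≤ k) (hmx : m x ≤ m y) :
    m ∈ edgePow G A k ↔
      Function.update m y (m y - m x) ∈ edgePow G (A.erase x) (k - m x) := by
  have hne := hxy.ne
  set n := m - Pi.single x (m x) - Pi.single y (m x) with hn
  have hmn : m = n + Pi.single x (m x) + Pi.single y (m x) := by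
    funext w
    simp only [hn, Pi.add_apply, Pi.sub_apply, Pi.single_apply]
    split_ifs <;> simp_all
  conv_lhs => rw [hmn]
  rw [leaf_iff_add hx hy hxy hleaf hmk, erase_of_eq_zero (v := x) (by simp [hn])]
  refine congr_on fun w hw => ?_
  have := Finset.ne_of_mem_erase hw
  rcases eq_or_ne w y with rfl | hwy
  · simp [hn, hne.symm]
  · simp [hn, hwy, this]

end Leaf

section Disjoint

theorem union_of (hA : m ∈ edgePow G A k) (hB : m ∈ edgePow G B l) (hAB : Disjoint A B) :
    m ∈ edgePow G (A ∪ B) (k + l) := by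
  induction k generalizing m with
  | zero => simpa using mono Finset.subset_union_right hB
  | succ k ih =>
    obtain ⟨i, hi, j, hj, hij, m', hm', rfl⟩ := hA
    rw [add_right_comm]
    refine add_edge (ih hm' ((congr_on fun v hv => ?_).1 hB)) (Finset.mem_union_left _ hi)
      (Finset.mem_union_left _ hj) hij
    have hi' : v ≠ i := fun h => Finset.disjoint_left.1 hAB hi (h ▸ hv)
    have hj' : v ≠ j := fun h => Finset.disjoint_left.1 hAB hj (h ▸ hv)
    simp [hi', hj']

theorem exists_of_union (h : ∀ i ∈ A, ∀ j ∈ B, ¬ G.Adj i j) (hm : m ∈ edgePow G (A ∪ B) k) :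
    ∃ a b, a + b = k ∧ m ∈ edgePow G A a ∧ m ∈ edgePow G B b := by
  induction k generalizing m with
  | zero => exact ⟨0, 0, rfl, trivial, trivial⟩
  | succ k ih =>
    obtain ⟨i, hi, j, hj, hij, m', hm', rfl⟩ := hm
    obtain ⟨a, b, rfl, ha, hb⟩ := ih hm'
    have hle : m' ≤ m' + Pi.single i 1 + Pi.single j 1 := by
      rw [add_assoc]
      exact le_self_add
    rcases Finset.mem_union.1 hi with hi | hi <;> rcases Finset.mem_union.1 hj with hj | hj
    · exact ⟨a + 1, b, by omega, add_edge ha hi hj hij, of_le hle hb⟩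
    · exact absurd hij (h i hi j hj)
    · exact absurd hij.symm (h j hj i hi)
    · exact ⟨a, b + 1, by omega, of_le hle ha, add_edge hb hi hj hij⟩

end Disjoint

end edgePow

end EdgePow

/-! ### Weighted König theorem and layers of bipartite graphs -/

section Bipartite

variable {V : Type*} [DecidableEq V] {G : SimpleGraph V} {A : Finset V} {k : ℕ} {m : V → ℕ}

/-- A weighted form of the easy half of König's theorem. -/
theorem edgePow.le_sum_cover {W : Finset V} (hW : ∀ i ∈ A, ∀ j ∈ A, G.Adj i j → i ∈ W ∨ j ∈ W)
    (hm : m ∈ edgePow G A k) : k ≤ ∑ v ∈ W, m v := by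
  induction k generalizing m with
  | zero => exact Nat.zero_le _
  | succ k ih =>
    obtain ⟨i, hi, j, hj, hij, m', hm', rfl⟩ := hm
    have := ih hm'
    simp only [Pi.add_apply, Finset.sum_add_distrib, Finset.sum_pi_single']
    rcases hW i hi j hj hij with h | h <;> simp only [h, if_true] <;> omega

theorem edgePow.of_matching {ι : Type*} [DecidableEq ι] (J : Finset ι) (a b : ι → V)
    (hab : ∀ p ∈ J, a p ∈ A ∧ b p ∈ A ∧ G.Adj (a p) (b p))
    (hm : ∀ v, (J.filter (a · = v)).card + (J.filter (b · = v)).card ≤ m v) :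
    m ∈ edgePow G A J.card := by
  have key : ∑ p ∈ J, (Pi.single (a p) 1 + Pi.single (b p) 1 : V → ℕ) ∈ edgePow G A J.card := by
    clear hm
    induction J using Finset.induction_on with
    | empty => exact trivial
    | insert p J hp ih =>
      rw [Finset.sum_insert hp, Finset.card_insert_of_notMem hp, add_comm (_ + _),
        ← add_assoc]
      obtain ⟨h1, h2, h3⟩ := hab p (Finset.mem_insert_self p J)
      exact edgePow.add_edge (ih fun q hq => hab q (Finset.mem_insert_of_mem hq)) h1 h2 h3
  refine edgePow.of_le (fun v => le_trans (le_of_eq ?_) (hm v)) key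
  simp [Finset.sum_apply, Finset.sum_add_distrib, Pi.single_apply, Finset.sum_boole, eq_comm]

/-- The weighted form of König's theorem, for the induced bipartite graph on `A`. -/
theorem edgePow.exists_cover (c : V → Prop) (hc : ∀ i ∈ A, ∀ j ∈ A, G.Adj i j → (c i ↔ ¬ c j))
    (hm : m ∉ edgePow G A k) : ∃ W ⊆ A, (∀ i ∈ A, ∀ j ∈ A, G.Adj i j → i ∈ W ∨ j ∈ W) ∧
      ∑ v ∈ W, m v < k := by
  classical
  by_contra! hcov
  apply hm
  set X := A.filter c with hX
  set Y := A.filter (¬ c ·) with hY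
  have hkX : k ≤ ∑ v ∈ X, m v := by
    refine hcov X (Finset.filter_subset _ _) fun i hi j hj hij => ?_
    have := hc i hi j hj hij
    simp only [hX, Finset.mem_filter, hi, hj, true_and]
    tauto
  -- Deficiency form of Hall's theorem: each `v` in `X` is replaced by `m v` copies, to be matched
  -- with copies of neighbours or with one of `∑ v ∈ X, m v - k` dummies. By `hkX` this subtraction
  -- is exact.
  let T : Finset (Σ _ : V, ℕ) := X.sigma fun v => Finset.range (m v)
  let N : V → Finset V := fun u => Y.filter (G.Adj u)
  let t : T → Finset ((Σ _ : V, ℕ) ⊕ ℕ) := fun p =>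
    ((N p.1.1).sigma fun v => Finset.range (m v)).disjSum (Finset.range (∑ v ∈ X, m v - k))
  have hTX : ∀ p : T, p.1.1 ∈ X ∧ p.1.2 < m p.1.1 := fun p => by
    simpa only [T, Finset.mem_sigma, Finset.mem_range] using p.2
  obtain ⟨f, hf, hft⟩ := (Finset.all_card_le_biUnion_card_iff_exists_injective t).1 (by
    intro S
    rcases S.eq_empty_or_nonempty with rfl | ⟨p₀, hp₀⟩
    · simp
    set S' := S.image (·.1.1) with hS'
    have hS'X : S' ⊆ X := by
      intro v hv
      obtain ⟨p, -, rfl⟩ := Finset.mem_image.1 hv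
      exact (hTX p).1
    have h1 : S.card ≤ ∑ v ∈ S', m v := by
      have h : S.map (Function.Embedding.subtype _) ⊆
          S'.sigma fun v => Finset.range (m v) := by
        intro q hq
        obtain ⟨p, hp, rfl⟩ := Finset.mem_map.1 hq
        exact Finset.mem_sigma.2 ⟨Finset.mem_image_of_mem _ hp, by simpa using (hTX p).2⟩
      simpa using Finset.card_le_card h
    have h2 : ∑ v ∈ S'.biUnion N, m v + (∑ v ∈ X, m v - k) ≤ (S.biUnion t).card := by
      have h : (((S'.biUnion N).sigma fun v => Finset.range (m v)).disjSum
          (Finset.range (∑ v ∈ X, m v - k))) ⊆ S.biUnion t := by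
        intro q hq
        rcases Finset.mem_disjSum.1 hq with ⟨r, hr, rfl⟩ | ⟨r, hr, rfl⟩
        · obtain ⟨hr1, hr2⟩ := Finset.mem_sigma.1 hr
          obtain ⟨u, hu, hru⟩ := Finset.mem_biUnion.1 hr1
          obtain ⟨p, hp, rfl⟩ := Finset.mem_image.1 hu
          refine Finset.mem_biUnion.2 ⟨p, hp, ?_⟩
          exact Finset.inl_mem_disjSum.2 (Finset.mem_sigma.2 ⟨hru, hr2⟩)
        · exact Finset.mem_biUnion.2 ⟨p₀, hp₀, Finset.inr_mem_disjSum.2 hr⟩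
      simpa using Finset.card_le_card h
    -- Hall's condition comes from the cover consisting of `X \ S'` and the neighbours of `S'`.
    have h3 : k ≤ ∑ v ∈ X \ S', m v + ∑ v ∈ S'.biUnion N, m v := by
      refine (hcov ((X \ S') ∪ S'.biUnion N) ?_ ?_).trans ?_
      · refine Finset.union_subset (Finset.sdiff_subset.trans (Finset.filter_subset _ _))
          (Finset.biUnion_subset.2 fun u _ => (Finset.filter_subset _ _).trans
            (Finset.filter_subset _ _))
      · have aux : ∀ i ∈ A, ∀ j ∈ A, G.Adj i j → c i →
            i ∈ (X \ S') ∪ S'.biUnion N ∨ j ∈ (X \ S') ∪ S'.biUnion N := by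
          intro i hi j hj hij hci
          by_cases his : i ∈ S'
          · refine .inr (Finset.mem_union_right _ (Finset.mem_biUnion.2 ⟨i, his, ?_⟩))
            simp [N, hY, hj, hij, (hc i hi j hj hij).1 hci]
          · refine .inl (Finset.mem_union_left _ ?_)
            simp [hX, hi, hci, his]
        intro i hi j hj hij
        by_cases hci : c i
        · exact aux i hi j hj hij hci
        · exact (aux j hj i hi hij.symm (by have := hc i hi j hj hij; tauto)).symm
      · rw [← Finset.sum_union_inter]
        exact Nat.le_add_right _ _
    have h4 := Finset.sum_sdiff (f := m) hS'X
    omega)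
  -- The copies not matched to dummies: at least `k` of them, by the number of dummies.
  let J : Finset T := Finset.univ.filter fun p => (f p).isLeft
  have hJ : k ≤ J.card := by
    have h1 : (Finset.univ.filter fun p => ¬ (f p).isLeft).card ≤ ∑ v ∈ X, m v - k := by
      refine (Finset.card_le_card_of_injOn f (t := (Finset.range (∑ v ∈ X, m v - k)).map
        Function.Embedding.inr) ?_ hf.injOn).trans (by simp)
      intro p hp
      have h := hft p
      simp only [Finset.coe_filter, Finset.mem_univ, true_and, Set.mem_ofPred_eq] at hp
      rcases hfp : f p with q | q
      · simp [hfp] at hp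
      · rw [hfp] at h
        simpa [t] using h
    have h2 : J.card + _ = _ := Finset.card_filter_add_card_filter_not
      (s := (Finset.univ : Finset T)) (fun p => (f p).isLeft = true)
    have h3 : (Finset.univ : Finset T).card = ∑ v ∈ X, m v := by simp [T]
    omega
  let q : T → Σ _ : V, ℕ := fun p => (f p).elim id fun _ => p.1
  have hq : ∀ p ∈ J, f p = .inl (q p) ∧ q p ∈ (N p.1.1).sigma fun v => Finset.range (m v) := by
    intro p hp
    have h := hft p
    rcases hfp : f p with r | r
    · rw [hfp] at h
      simpa [q, hfp, t] using h
    · simp [J, hfp] at hp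
  have hq' : ∀ p ∈ J, (q p).1 ∈ A ∧ ¬ c (q p).1 ∧ G.Adj p.1.1 (q p).1 ∧ (q p).2 < m (q p).1 := by
    intro p hp
    have := (hq p hp).2
    simpa [N, hY, and_assoc] using this
  refine edgePow.antitone hJ (edgePow.of_matching J (fun p => p.1.1) (fun p => (q p).1)
    (fun p hp => ⟨(Finset.mem_filter.1 (hTX p).1).1, (hq' p hp).1, (hq' p hp).2.2.1⟩) fun v => ?_)
  by_cases hv : c v
  · have h1 : (J.filter fun p => (q p).1 = v) = ∅ := by
      rw [Finset.filter_eq_empty_iff]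
      rintro p hp rfl
      exact (hq' p hp).2.1 hv
    have h2 : (J.filter fun p => p.1.1 = v).card ≤ (Finset.range (m v)).card := by
      refine Finset.card_le_card_of_injOn (fun p => p.1.2) ?_ ?_
      · intro p hp
        obtain ⟨-, rfl⟩ := Finset.mem_filter.1 hp
        simpa using (hTX p).2
      · intro p hp p' hp' h
        have e1 := (Finset.mem_filter.1 hp).2
        have e2 := (Finset.mem_filter.1 hp').2
        exact Subtype.ext (Sigma.ext (e1.trans e2.symm) (heq_of_eq h))
    simpa [h1] using h2
  · have h1 : (J.filter fun p => p.1.1 = v) = ∅ := by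
      rw [Finset.filter_eq_empty_iff]
      rintro p hp rfl
      exact hv (Finset.mem_filter.1 (hTX p).1).2
    have h2 : (J.filter fun p => (q p).1 = v).card ≤ (Finset.range (m v)).card := by
      refine Finset.card_le_card_of_injOn (fun p => (q p).2) ?_ ?_
      · intro p hp
        obtain ⟨hp', rfl⟩ := Finset.mem_filter.1 hp
        simpa using (hq' p hp').2.2.2
      · intro p hp p' hp' h
        obtain ⟨hp, e1⟩ := Finset.mem_filter.1 hp
        obtain ⟨hp', e2⟩ := Finset.mem_filter.1 hp'
        refine hf ?_
        rw [(hq p hp).1, (hq p' hp').1]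
        exact congrArg _ (Sigma.ext (e1.trans e2.symm) (heq_of_eq h))
    simpa [h1] using h2

variable [Fintype V]

/-- `I ^ k / I ^ (k + 1)` has Stanley depth at least one for a bipartite graph. -/
theorem edgePow.stanleyPartition_layer (hA : A.Nonempty) (c : V → Prop)
    (hc : ∀ i ∈ A, ∀ j ∈ A, G.Adj i j → (c i ↔ ¬ c j)) (k : ℕ) :
    StanleyPartition A 1 (edgePow G A k \ edgePow G A (k + 1)) := by
  classical
  refine stanleyPartition_diff (edgePow.tame.mono (by omega : 2 * k ≤ 2 * (k + 1)))
    edgePow.tame edgePow.isUpperSet edgePow.isUpperSet fun m _ hm => ?_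
  obtain ⟨W, hWA, hW, hlt, v, hv, hvW⟩ : ∃ W ⊆ A,
      (∀ i ∈ A, ∀ j ∈ A, G.Adj i j → i ∈ W ∨ j ∈ W) ∧ ∑ v ∈ W, m v < k + 1 ∧
      ∃ v ∈ A, v ∉ W := by
    obtain ⟨W, hWA, hW, hlt⟩ := edgePow.exists_cover c hc hm
    -- A cover that is all of `A` leaves no free direction; it is replaced by a colour class, or by
    -- the empty set when only one colour occurs and there are no edges.
    by_cases hAW : A ⊆ W
    · have hle : ∀ W' ⊆ A, ∑ v ∈ W', m v < k + 1 := fun W' h =>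
        (Finset.sum_le_sum_of_subset (h.trans hAW)).trans_lt hlt
      by_cases hcA : ∀ v ∈ A, c v
      · refine ⟨∅, by simp, fun i hi j hj hij => ?_, hle _ (by simp), hA.imp fun v hv => by simpa⟩
        exact absurd (hcA j hj) ((hc i hi j hj hij).1 (hcA i hi))
      · push Not at hcA
        refine ⟨A.filter c, Finset.filter_subset _ _, fun i hi j hj hij => ?_,
          hle _ (Finset.filter_subset _ _), hcA.imp fun v hv => ⟨hv.1, by simp [hv.2]⟩⟩
        have := hc i hi j hj hij
        simp only [Finset.mem_filter, hi, hj, true_and]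
        tauto
    · exact ⟨W, hWA, hW, hlt, Finset.not_subset.1 hAW⟩
  refine ⟨v, hv, fun t ht => ?_⟩
  have := edgePow.le_sum_cover hW ht
  simp only [Pi.add_apply, Finset.sum_add_distrib, Finset.sum_pi_single', hvW, if_false] at this
  omega

theorem edgePow.stanleyPartition_zero : StanleyPartition A 0 (edgePow G A k) :=
  edgePow.tame.stanleyPartition

theorem edgePow.stanleyPartition_layer_zero :
    StanleyPartition A 0 (edgePow G A k \ edgePow G A (k + 1)) :=
  ((edgePow.tame.mono (by omega : 2 * k ≤ 2 * (k + 1))).inter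
    edgePow.tame.compl).stanleyPartition

theorem edgePow.stanleyPartition_one (h : A.Nonempty ∨ 1 ≤ k) :
    StanleyPartition A 1 (edgePow G A k) := by
  rcases A.eq_empty_or_nonempty with rfl | ⟨v, hv⟩
  · rw [edgePow.eq_empty (by simp) (by simpa using h)]
    exact StanleyPartition.empty
  · exact edgePow.tame.stanleyPartition_one hv fun m hm => edgePow.of_le (by simp) hm

end Bipartite

/-! ### Powers of edge ideals of forests -/

section Forest

variable {V : Type*} [DecidableEq V] [Fintype V] {G : SimpleGraph V}

/-- If every subset of `A` which spans an edge contains a leaf, then the positive powers of the edge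
ideal of the induced subgraph on `A` have Stanley depth at least two. -/
theorem edgePow.stanleyPartition_two {A : Finset V}
    (hA : ∀ B ⊆ A, (∃ i ∈ B, ∃ j ∈ B, G.Adj i j) →
      ∃ x ∈ B, ∃ y ∈ B, G.Adj x y ∧ ∀ z ∈ B, G.Adj x z → z = y)
    {k : ℕ} (hk : 1 ≤ k) : StanleyPartition A 2 (edgePow G A k) := by
  induction hn : A.card using Nat.strong_induction_on generalizing A k with
  | _ n ih =>
  by_cases hE : ∃ i ∈ A, ∃ j ∈ A, G.Adj i j
  swap
  · push Not at hE
    rw [edgePow.eq_empty hE hk]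
    exact StanleyPartition.empty
  obtain ⟨x, hx, y, hy, hxy, hleaf⟩ := hA A subset_rfl hE
  have hne := hxy.ne
  have hyx : y ∈ A.erase x := Finset.mem_erase.2 ⟨hne.symm, hy⟩
  have hA₁ : A = {x} ∪ A.erase x := by
    rw [← Finset.insert_eq, Finset.insert_erase hx]
  have hA₂ : A = ({y} ∪ {x}) ∪ (A.erase y).erase x := by
    rw [Finset.union_assoc, ← Finset.insert_eq, ← Finset.insert_eq,
      Finset.insert_erase (Finset.mem_erase.2 ⟨hne, hx⟩), Finset.insert_erase hy]
  have hd₂ : Disjoint (({y} : Finset V) ∪ {x}) ((A.erase y).erase x) := by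
    rw [Finset.disjoint_left]
    intro v hv
    simp only [Finset.mem_union, Finset.mem_singleton] at hv
    rcases hv with rfl | rfl <;> simp
  have hdyx : Disjoint ({y} : Finset V) {x} := by simpa using hne.symm
  -- The region `m y ≤ m x`, `m y < k`: one free direction from `x`, one from the remaining
  -- vertices.
  have h₁ : StanleyPartition A 2 {m | ∃ t ∈ Finset.range k, m ∈ {m : V → ℕ | m y = t} ∩
      {m | t ≤ m x} ∩ edgePow G ((A.erase y).erase x) (k - t)} := by
    refine StanleyPartition.of_fibers _ _ (fun t ht => ?_) ?_
    · rw [hA₂]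
      have ht := Finset.mem_range.1 ht
      refine StanleyPartition.inter (d := 1) (e := 1) ?_ ?_ hd₂
      · exact (StanleyPartition.setOf_eq y t).inter (StanleyPartition.setOf_ge x t) hdyx
      · exact hA₂ ▸ edgePow.stanleyPartition_one (.inr (by omega))
    · rintro m i _ j _ ⟨⟨rfl, -⟩, -⟩ ⟨⟨rfl, -⟩, -⟩
      rfl
  -- The region `m x < m y`, `m x < k`: both directions come from induction on `A.erase x`. The
  -- condition `1 ≤ m y` after the shift makes the inequality strict, hence disjoint from `h₁`.
  have h₂ : StanleyPartition A 2 {m | ∃ t ∈ Finset.range k, m ∈ {m : V → ℕ | m x = t} ∩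
      {m | t ≤ m y ∧ Function.update m y (m y - t) ∈
        edgePow G (A.erase x) (k - t) ∩ {m | 1 ≤ m y}}} := by
    refine StanleyPartition.of_fibers _ _ (fun t ht => ?_) ?_
    · have ht := Finset.mem_range.1 ht
      have h := ih (A.erase x).card (by rw [← hn]; exact Finset.card_erase_lt_of_mem hx)
        (fun B hB => hA B (hB.trans (Finset.erase_subset x A))) (show 1 ≤ k - t by omega) rfl
      have h := (StanleyPartition.setOf_eq x t).inter ((h.inter_ge y hyx 1).shift y hyx t)
        (by simp)
      rwa [← hA₁] at h
    · rintro m i _ j _ ⟨rfl, -⟩ ⟨rfl, -⟩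
      rfl
  -- Here the edge `xy` alone can be used `k` times, so `x` and `y` are both free.
  have h₃ : StanleyPartition A 2 ({m : V → ℕ | k ≤ m y} ∩ {m | k ≤ m x}) := by
    have h := ((StanleyPartition.setOf_ge y k).inter (StanleyPartition.setOf_ge x k) hdyx).inter
      ((StanleyPartition.univ ((A.erase y).erase x)).mono (Nat.zero_le _)) hd₂
    rw [← hA₂] at h
    exact h.congr (by simp)
  refine ((h₁.union h₂ ?_).union h₃ ?_).congr fun m => ?_
  · rw [Set.disjoint_left]
    rintro m ⟨i, hi, ⟨h1, h2⟩, -⟩ ⟨j, hj, h3, h4, -, h5⟩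
    simp only [Set.mem_ofPred_eq, Function.update_self] at h1 h2 h3 h4 h5
    omega
  · rw [Set.disjoint_left]
    rintro m (⟨i, hi, ⟨h1, -⟩, -⟩ | ⟨i, hi, h1, -⟩) ⟨h2, h3⟩ <;>
    · simp only [Set.mem_ofPred_eq, Finset.mem_range] at *
      omega
  · simp only [Set.mem_union, Set.mem_inter_iff, Set.mem_ofPred_eq, Finset.mem_range]
    have hge := edgePow.leaf_ge (m := m) (k := k) hx hy hxy hleaf
    have hle := edgePow.leaf_le (m := m) (k := k) hx hy hxy hleaf
    simp only [Function.update_self]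
    constructor
    · intro hm
      by_cases h : k ≤ m y ∧ k ≤ m x
      · exact .inr h
      refine .inl ?_
      rcases le_or_gt (m y) (m x) with h' | h'
      · exact .inl ⟨m y, by omega, ⟨rfl, h'⟩, (hge (by omega) h').1 hm⟩
      · exact .inr ⟨m x, by omega, rfl, h'.le, (hle (by omega) h'.le).1 hm, by omega⟩
    · rintro ((⟨t, ht, ⟨rfl, h2⟩, h3⟩ | ⟨t, ht, rfl, h2, h3, -⟩) | ⟨h1, h2⟩)
      · exact (hge ht.le h2).2 h3
      · exact (hle ht.le h2).2 h3
      · have : (0 : V → ℕ) + Pi.single x k + Pi.single y k ∈ edgePow G A k := by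
          rw [edgePow.leaf_iff_add hx hy hxy hleaf le_rfl, Nat.sub_self]
          trivial
        refine edgePow.of_le (fun v => ?_) this
        rcases eq_or_ne v x with rfl | hvx
        · simpa [hne] using h2
        rcases eq_or_ne v y with rfl | hvy
        · simpa [hne.symm] using h1
        · simp [hvx, hvy]

end Forest

/-! ### Vertex sets of connected components -/

section ComponentVerts

variable {V : Type*} [Fintype V] {G : SimpleGraph V}

open Classical in
/-- The vertices which lie in one of the components in `S`. -/
noncomputable def componentVerts (S : Finset G.ConnectedComponent) : Finset V :=
  Finset.univ.filter fun v => G.connectedComponentMk v ∈ S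

theorem mem_componentVerts {S : Finset G.ConnectedComponent} {v : V} :
    v ∈ componentVerts S ↔ G.connectedComponentMk v ∈ S := by
  simp [componentVerts]

theorem componentVerts_disjoint {S T : Finset G.ConnectedComponent} (h : Disjoint S T) :
    Disjoint (componentVerts S) (componentVerts T) := by
  rw [Finset.disjoint_left] at h ⊢
  intro v hS hT
  exact h (mem_componentVerts.1 hS) (mem_componentVerts.1 hT)

theorem componentVerts_not_adj {S T : Finset G.ConnectedComponent} (h : Disjoint S T) :
    ∀ i ∈ componentVerts S, ∀ j ∈ componentVerts T, ¬ G.Adj i j := by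
  intro i hi j hj hij
  rw [mem_componentVerts] at hi hj
  rw [SimpleGraph.ConnectedComponent.connectedComponentMk_eq_of_adj hij] at hi
  exact Finset.disjoint_left.1 h hi hj

theorem componentVerts_insert [DecidableEq V] [DecidableEq G.ConnectedComponent]
    (C : G.ConnectedComponent) (S : Finset G.ConnectedComponent) :
    componentVerts (insert C S) = componentVerts S ∪ componentVerts {C} := by
  ext v
  simp [mem_componentVerts, or_comm]

theorem componentVerts_singleton_nonempty (C : G.ConnectedComponent) :
    (componentVerts {C}).Nonempty := by
  obtain ⟨v, rfl⟩ := C.exists_rep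
  exact ⟨v, mem_componentVerts.2 (Finset.mem_singleton_self _)⟩

theorem exists_bicoloring_of_isBipartite {C : G.ConnectedComponent}
    (hC : C.toSimpleGraph.IsBipartite) : ∃ c : V → Prop,
      ∀ i ∈ componentVerts {C}, ∀ j ∈ componentVerts {C}, G.Adj i j → (c i ↔ ¬ c j) := by
  obtain ⟨f⟩ := hC
  refine ⟨fun v => ∃ h : v ∈ C.supp, f ⟨v, h⟩ = 0, fun i hi j hj hij => ?_⟩
  have hi' : i ∈ C.supp := by simpa [mem_componentVerts] using hi
  have hj' : j ∈ C.supp := by simpa [mem_componentVerts] using hj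
  have := f.valid (v := ⟨i, hi'⟩) (w := ⟨j, hj'⟩) hij
  simp only [hi', hj', exists_true_left]
  omega

/-- The subgraph induced on `B` is acyclic, so its component containing the given edge is a
nontrivial finite tree, which has a vertex of degree one. -/
theorem exists_leaf_of_isAcyclic {C : G.ConnectedComponent} (hC : C.toSimpleGraph.IsAcyclic)
    (B : Finset V) (hB : B ⊆ componentVerts {C}) (hE : ∃ i ∈ B, ∃ j ∈ B, G.Adj i j) :
    ∃ x ∈ B, ∃ y ∈ B, G.Adj x y ∧ ∀ z ∈ B, G.Adj x z → z = y := by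
  classical
  have hBC : ∀ v ∈ B, v ∈ C.supp := fun v hv => by
    simpa [mem_componentVerts] using hB hv
  have hH : (G.induce (B : Set V)).IsAcyclic :=
    hC.comap (G := G.induce (B : Set V)) ⟨fun v => ⟨v.1, hBC v.1 v.2⟩, fun h => h⟩
      fun v w h => Subtype.ext (congrArg (fun u : C.supp => u.1) h)
  obtain ⟨i, hi, j, hj, hij⟩ := hE
  set D := (G.induce (B : Set V)).connectedComponentMk ⟨i, hi⟩ with hD
  have hjD : (⟨j, hj⟩ : (B : Set V)) ∈ D :=
    (SimpleGraph.ConnectedComponent.connectedComponentMk_eq_of_adj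
      (show (G.induce (B : Set V)).Adj ⟨i, hi⟩ ⟨j, hj⟩ from hij)).symm
  have hT : D.toSimpleGraph.IsTree := hH.isTree_connectedComponent D
  have : Nontrivial D := ⟨⟨⟨⟨i, hi⟩, rfl⟩, ⟨⟨j, hj⟩, hjD⟩, fun h =>
    hij.ne (congrArg (fun v => v.1.1) h)⟩⟩
  have : Fintype D := Fintype.ofFinite D
  obtain ⟨x, hx⟩ := hT.exists_vert_degree_one_of_nontrivial
  obtain ⟨y, hxy, huniq⟩ := SimpleGraph.degree_eq_one_iff_existsUnique_adj.1 hx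
  refine ⟨x.1.1, x.1.2, y.1.1, y.1.2, hxy, fun z hz hxz => ?_⟩
  have hzD : (⟨z, hz⟩ : (B : Set V)) ∈ D := D.mem_supp_of_adj_mem_supp x.2 hxz
  exact congrArg (fun v => v.1.1) (huniq ⟨⟨z, hz⟩, hzD⟩ hxz)

end ComponentVerts

/-! ### Assembling the components -/

section Components

variable {V : Type*} [DecidableEq V] {G : SimpleGraph V} {A B : Finset V} {m : V → ℕ}

theorem edgePow.exists_layer {k : ℕ} (hm : m ∉ edgePow G A k) :
    ∃ i < k, m ∈ edgePow G A i \ edgePow G A (i + 1) := by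
  induction k with
  | zero => exact absurd trivial hm
  | succ k ih =>
    by_cases h : m ∈ edgePow G A k
    · exact ⟨k, by omega, h, hm⟩
    · obtain ⟨i, hi, h⟩ := ih h
      exact ⟨i, by omega, h⟩

theorem edgePow.layer_unique {i j : ℕ} (hi : m ∈ edgePow G A i \ edgePow G A (i + 1))
    (hj : m ∈ edgePow G A j \ edgePow G A (j + 1)) : i = j := by
  by_contra hij
  rcases Nat.lt_or_gt_of_ne hij with h | h
  · exact hi.2 (edgePow.antitone h hj.1)
  · exact hj.2 (edgePow.antitone h hi.1)

theorem edgePow.le_of_layer {i j : ℕ} (hi : m ∈ edgePow G A i \ edgePow G A (i + 1))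
    (hj : m ∈ edgePow G A j) : j ≤ i := by
  by_contra h
  exact hi.2 (edgePow.antitone (Nat.lt_of_not_le h) hj)

section Union

variable (hAB : Disjoint A B) (hG : ∀ i ∈ A, ∀ j ∈ B, ¬ G.Adj i j) {d e : ℕ}

include hAB hG

/-- The layer index `i` is the largest number of edges that fit inside `A`; the other `k - i` must
fit inside `B`. -/
theorem edgePow.mem_union_iff_of_layer {i k : ℕ}
    (hi : m ∈ edgePow G A i \ edgePow G A (i + 1)) (hik : i ≤ k) :
    m ∈ edgePow G (A ∪ B) k ↔ m ∈ edgePow G B (k - i) := by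
  constructor
  · intro h
    obtain ⟨a, b, rfl, ha, hb⟩ := edgePow.exists_of_union hG h
    have := edgePow.le_of_layer hi ha
    exact edgePow.antitone (by omega) hb
  · intro h
    have := edgePow.union_of hi.1 h hAB
    rwa [Nat.add_sub_cancel' hik] at this

theorem edgePow.layer_union
    (hA : ∀ k, StanleyPartition A d (edgePow G A k \ edgePow G A (k + 1)))
    (hB : ∀ k, StanleyPartition B e (edgePow G B k \ edgePow G B (k + 1))) (k : ℕ) :
    StanleyPartition (A ∪ B) (d + e) (edgePow G (A ∪ B) k \ edgePow G (A ∪ B) (k + 1)) := by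
  refine (StanleyPartition.of_fibers (Finset.range (k + 1))
    (fun i => (edgePow G A i \ edgePow G A (i + 1)) ∩
      (edgePow G B (k - i) \ edgePow G B (k - i + 1)))
    (fun i _ => (hA i).inter (hB _) hAB)
    fun m i _ j _ hi hj => edgePow.layer_unique hi.1 hj.1).congr fun m => ?_
  constructor
  · intro hm
    have hA' : m ∉ edgePow G A (k + 1) :=
      fun h => hm.2 (edgePow.mono Finset.subset_union_left h)
    obtain ⟨i, hi, hmi⟩ := edgePow.exists_layer hA'
    refine ⟨i, Finset.mem_range.2 hi, hmi,
      (edgePow.mem_union_iff_of_layer hAB hG hmi (by omega)).1 hm.1, fun h => hm.2 ?_⟩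
    refine (edgePow.mem_union_iff_of_layer hAB hG hmi (by omega)).2 ?_
    rwa [Nat.succ_sub (by omega)]
  · rintro ⟨i, hi, hmi, h1, h2⟩
    rw [Finset.mem_range] at hi
    rw [Set.mem_sdiff, edgePow.mem_union_iff_of_layer hAB hG hmi (by omega),
      edgePow.mem_union_iff_of_layer hAB hG hmi (by omega), Nat.succ_sub (by omega)]
    exact ⟨h1, h2⟩

variable [Fintype V]

/-- The set splits into layers of `A` below `k`, each times a positive power on `B`, and `edgePow G
A k` times the full space on `B`; `hd` covers the last piece. -/
theorem edgePow.pow_union {d' e' k : ℕ}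
    (hA : ∀ i, StanleyPartition A d (edgePow G A i \ edgePow G A (i + 1)))
    (hB : ∀ i, 1 ≤ i → StanleyPartition B e (edgePow G B i))
    (hAk : StanleyPartition A d' (edgePow G A k)) (hd : d + e ≤ d' + B.card)
    (he : e' = d + e) :
    StanleyPartition (A ∪ B) e' (edgePow G (A ∪ B) k) := by
  subst he
  refine ((StanleyPartition.of_fibers (Finset.range k)
    (fun i => (edgePow G A i \ edgePow G A (i + 1)) ∩ edgePow G B (k - i))
    (fun i hi => (hA i).inter (hB _ ?_) hAB)
    fun m i _ j _ hi hj => edgePow.layer_unique hi.1 hj.1).union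
      ((hAk.inter (StanleyPartition.univ B) hAB).mono hd) ?_).congr fun m => ?_
  · have := Finset.mem_range.1 hi
    omega
  · rw [Set.disjoint_left]
    rintro m ⟨i, hi, hmi, -⟩ ⟨hmk, -⟩
    have := edgePow.le_of_layer hmi hmk
    have := Finset.mem_range.1 hi
    omega
  · constructor
    · intro hm
      by_cases hmk : m ∈ edgePow G A k
      · exact .inr ⟨hmk, trivial⟩
      · obtain ⟨i, hi, hmi⟩ := edgePow.exists_layer hmk
        exact .inl ⟨i, Finset.mem_range.2 hi, hmi,
          (edgePow.mem_union_iff_of_layer hAB hG hmi hi.le).1 hm⟩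
    · rintro (⟨i, hi, hmi, h⟩ | ⟨h, -⟩)
      · exact (edgePow.mem_union_iff_of_layer hAB hG hmi (Finset.mem_range.1 hi).le).2 h
      · exact edgePow.mono Finset.subset_union_left h

end Union

variable [Fintype V]

open Classical in
-- Layers and powers are treated together because the step for powers needs the layers of the
-- components already joined.
theorem stanleyPartition_components (S : Finset G.ConnectedComponent) :
    (∀ k, StanleyPartition (componentVerts S)
      (S.filter fun C => C.toSimpleGraph.IsBipartite).card
      (edgePow G (componentVerts S) k \ edgePow G (componentVerts S) (k + 1))) ∧
    ∀ k, StanleyPartition (componentVerts S)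
      (S.filter fun C => C.toSimpleGraph.IsBipartite).card (edgePow G (componentVerts S) k) := by
  induction S using Finset.induction_on with
  | empty =>
    exact ⟨fun k => edgePow.stanleyPartition_layer_zero, fun k => edgePow.stanleyPartition_zero⟩
  | insert C S hC ih =>
    have hd : Disjoint S {C} := by simpa using hC
    have hpos := (componentVerts_singleton_nonempty C).card_pos
    rw [componentVerts_insert, Finset.filter_insert]
    split_ifs with hCb
    · obtain ⟨c, hc⟩ := exists_bicoloring_of_isBipartite hCb
      rw [Finset.card_insert_of_notMem (by simp [hC])]
      exact ⟨edgePow.layer_union (componentVerts_disjoint hd) (componentVerts_not_adj hd) ih.1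
          (edgePow.stanleyPartition_layer (componentVerts_singleton_nonempty C) c hc),
        fun k => edgePow.pow_union (componentVerts_disjoint hd) (componentVerts_not_adj hd) ih.1
          (fun i hi => edgePow.stanleyPartition_one (.inr hi)) (ih.2 k) (by omega) rfl⟩
    · exact ⟨edgePow.layer_union (e := 0) (componentVerts_disjoint hd)
          (componentVerts_not_adj hd) ih.1 fun k => edgePow.stanleyPartition_layer_zero,
        fun k => edgePow.pow_union (e := 0) (componentVerts_disjoint hd)
          (componentVerts_not_adj hd) ih.1
          (fun i hi => edgePow.stanleyPartition_zero) (ih.2 k) (by omega) rfl⟩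

theorem stanleyPartition_edgePow_univ
    (hG : ∃ H : G.ConnectedComponent, H.toSimpleGraph.IsTree ∧ H.toSimpleGraph.edgeSet.Nonempty)
    (k : ℕ) :
    StanleyPartition Finset.univ (numBipartiteComponents G + 1) (edgePow G Finset.univ k) := by
  classical
  obtain ⟨C, hC, ⟨e, he⟩⟩ := hG
  -- Needed for the piece of `edgePow.pow_union` in which every vertex of the tree is free.
  have hcard : 2 ≤ (componentVerts {C}).card := by
    induction e with
    | _ u v =>
      have huv : G.Adj u.1 v.1 := he
      exact Finset.one_lt_card.2 ⟨u.1, mem_componentVerts.2 (Finset.mem_singleton.2 u.2),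
        v.1, mem_componentVerts.2 (Finset.mem_singleton.2 v.2), huv.ne⟩
  set S := (Finset.univ : Finset G.ConnectedComponent).erase C with hS
  have huniv : (Finset.univ : Finset V) = componentVerts S ∪ componentVerts {C} := by
    rw [← componentVerts_insert, hS, Finset.insert_erase (Finset.mem_univ C)]
    ext v
    simp [mem_componentVerts]
  have hp : numBipartiteComponents G + 1 ≤
      (S.filter fun C => C.toSimpleGraph.IsBipartite).card + 2 := by
    have h1 : numBipartiteComponents G =
        ((Finset.univ : Finset G.ConnectedComponent).filter
          fun C => C.toSimpleGraph.IsBipartite).card := by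
      rw [numBipartiteComponents, Nat.card_eq_fintype_card, Fintype.card_subtype]
    have h2 : ((Finset.univ : Finset G.ConnectedComponent).filter
        fun C => C.toSimpleGraph.IsBipartite) ⊆
        insert C (S.filter fun C => C.toSimpleGraph.IsBipartite) := by
      intro D hD
      by_cases h : D = C <;> simp_all
    have h3 := (Finset.card_le_card h2).trans (Finset.card_insert_le _ _)
    omega
  have hd : Disjoint S {C} := by simp [hS]
  have h := stanleyPartition_components S
  rw [huniv]
  exact (edgePow.pow_union (componentVerts_disjoint hd) (componentVerts_not_adj hd) h.1
    (fun i hi => edgePow.stanleyPartition_two (exists_leaf_of_isAcyclic hC.isAcyclic) hi)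
    (h.2 k) (by omega) rfl).mono hp

end Components

/-! ### From cone partitions to Stanley decompositions -/

section Algebra

open MvPolynomial

variable {V : Type*} {K : Type*} [Field K]

theorem StanleyPartition.exists_family [DecidableEq V] {A : Finset V} {d : ℕ} {U : Set (V → ℕ)}
    (h : StanleyPartition A d U) : ∃ (ι : Type) (_ : Finite ι) (a : ι → V → ℕ) (Z : ι → Finset V),
      (∀ i, d ≤ (Z i).card) ∧ (Pairwise fun i j => Disjoint (_root_.cone (a i) (Z i))
        (_root_.cone (a j) (Z j))) ∧ U = ⋃ i, _root_.cone (a i) (Z i) := by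
  induction h with
  | empty =>
    exact ⟨Empty, inferInstance, Empty.elim, Empty.elim, by simp, fun i => i.elim, by simp⟩
  | cone a Z _ _ hd =>
    exact ⟨Unit, inferInstance, fun _ => a, fun _ => Z,
      fun _ => hd.trans (Finset.card_le_card Finset.inter_subset_left),
      fun i j h => absurd rfl h, (Set.iUnion_const _).symm⟩
  | union _ _ hUW ih₁ ih₂ =>
    obtain ⟨ι₁, _, a₁, Z₁, hd₁, hp₁, rfl⟩ := ih₁
    obtain ⟨ι₂, _, a₂, Z₂, hd₂, hp₂, rfl⟩ := ih₂
    simp only [Set.disjoint_iUnion_left, Set.disjoint_iUnion_right] at hUW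
    refine ⟨ι₁ ⊕ ι₂, inferInstance, Sum.elim a₁ a₂, Sum.elim Z₁ Z₂, ?_, ?_, ?_⟩
    · rintro (i | i)
      exacts [hd₁ i, hd₂ i]
    · rintro (i | i) (j | j) hij
      · exact hp₁ fun h => hij (h ▸ rfl)
      · exact hUW j i
      · exact (hUW i j).symm
      · exact hp₂ fun h => hij (h ▸ rfl)
    · simp [Set.iUnion_sum]

/-- Both sides are spanned by monomials, so direct sums of such spaces reduce to disjoint unions of
cones. -/
theorem stanleySpace_monomial (a : V →₀ ℕ) (Z : Finset V) :
    stanleySpace (monomial a (1 : K)) Z = restrictSupport K ((⇑) ⁻¹' cone (a : V → ℕ) Z) := by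
  have h : (supported K (Z : Set V)).toSubmodule =
      restrictSupport K {m : V →₀ ℕ | ∀ v ∉ Z, m v = 0} := by
    ext f
    simp only [Subalgebra.mem_toSubmodule, mem_supported, mem_restrictSupport_iff, Set.subset_def,
      Finset.mem_coe, mem_vars_iff_mem_support, Set.mem_ofPred_eq, Finsupp.mem_support_iff]
    exact ⟨fun h m hm v hv => by_contra fun h' => hv (h v ⟨m, hm, h'⟩),
      fun h v ⟨m, hm, hv⟩ => by_contra fun h' => hv (h m hm v h')⟩
  rw [stanleySpace, h, restrictSupport_eq_span, restrictSupport_eq_span, Submodule.map_span]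
  congr 1
  ext f
  simp only [Set.mem_image, exists_exists_and_eq_and, LinearMap.mulLeft_apply, monomial_mul,
    mul_one]
  constructor
  · rintro ⟨m, hm, rfl⟩
    exact ⟨a + m, fun v => ⟨by simp, fun hv => by simp [hm v hv]⟩, rfl⟩
  · rintro ⟨m, hm, rfl⟩
    refine ⟨m - a, fun v hv => by simp [(hm v).2 hv], ?_⟩
    rw [add_tsub_cancel_of_le fun v => (hm v).1]

theorem iSupIndep_restrictSupport {ι : Type*} (s : ι → Set (V →₀ ℕ))
    (hs : Pairwise fun i j => Disjoint (s i) (s j)) :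
    iSupIndep fun i => restrictSupport K (s i) := by
  intro i
  refine Disjoint.mono_right (c := restrictSupport K (s i)ᶜ)
    (iSup₂_le fun j hj => restrictSupport_mono K fun m hm hmi =>
      Set.disjoint_left.1 (hs hj) hm hmi) ?_
  rw [Submodule.disjoint_def]
  intro f h1 h2
  rw [mem_restrictSupport_iff] at h1 h2
  rw [← support_eq_empty, Finset.eq_empty_iff_forall_notMem]
  exact fun m hm => h2 hm (h1 hm)

theorem iSup_restrictSupport {ι : Type*} (s : ι → Set (V →₀ ℕ)) :
    ⨆ i, restrictSupport K (s i) = restrictSupport K (⋃ i, s i) := by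
  simp only [restrictSupport_eq_span, Set.image_iUnion, Submodule.span_iUnion]

theorem edgeIdeal_pow_eq_span [DecidableEq V] [Fintype V] (G : SimpleGraph V) (k : ℕ) :
    edgeIdeal K G ^ k = Ideal.span ((fun m => monomial m (1 : K)) ''
      {m : V →₀ ℕ | (m : V → ℕ) ∈ edgePow G Finset.univ k}) := by
  induction k with
  | zero =>
    rw [pow_zero, Ideal.one_eq_top, eq_comm, Ideal.eq_top_iff_one]
    exact Ideal.subset_span ⟨0, trivial, rfl⟩
  | succ k ih =>
    rw [pow_succ, ih, edgeIdeal, Ideal.span_mul_span']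
    congr 1
    ext f
    simp only [Set.mem_mul, Set.mem_image, Set.mem_ofPred_eq, exists_exists_and_eq_and]
    constructor
    · rintro ⟨m, hm, _, ⟨i, j, hij, rfl⟩, rfl⟩
      refine ⟨m + Finsupp.single i 1 + Finsupp.single j 1, ?_, ?_⟩
      · simp only [Finsupp.coe_add, Finsupp.single_eq_pi_single]
        exact edgePow.add_edge hm (Finset.mem_univ i) (Finset.mem_univ j) hij
      · simp [X, monomial_mul, add_assoc]
    · rintro ⟨m, ⟨i, -, j, -, hij, m', hm', hm⟩, rfl⟩
      refine ⟨Finsupp.equivFunOnFinite.symm m', hm', _, ⟨i, j, hij, rfl⟩, ?_⟩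
      have : m = Finsupp.equivFunOnFinite.symm m' + Finsupp.single i 1 + Finsupp.single j 1 := by
        apply DFunLike.coe_injective
        rw [hm]
        simp only [Finsupp.coe_add, Finsupp.single_eq_pi_single]
        rfl
      simp [this, X, monomial_mul, add_assoc]

theorem mem_edgeIdeal_pow [DecidableEq V] [Fintype V] (G : SimpleGraph V) (k : ℕ)
    (f : MvPolynomial V K) :
    f ∈ edgeIdeal K G ^ k ↔ ∀ m ∈ f.support, (m : V → ℕ) ∈ edgePow G Finset.univ k := by
  rw [edgeIdeal_pow_eq_span, mem_ideal_span_monomial_image]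
  exact forall₂_congr fun m _ =>
    ⟨fun ⟨n, hn, hnm⟩ => edgePow.of_le hnm hn, fun h => ⟨m, h, le_rfl⟩⟩

theorem le_sdepth_of_stanleyPartition [DecidableEq V] [Fintype V] {J : Ideal (MvPolynomial V K)}
    {A : Finset V} {d : ℕ} {U : Set (V → ℕ)} (hU : StanleyPartition A d U)
    (hJ : ∀ f, f ∈ J ↔ ∀ m ∈ f.support, (m : V → ℕ) ∈ U) : (d : ℕ∞) ≤ sdepth J := by
  obtain ⟨ι, _, a, Z, hd, hp, rfl⟩ := hU.exists_family
  let σ := Finite.equivFin ι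
  let b : ι → V →₀ ℕ := fun i => Finsupp.equivFunOnFinite.symm (a i)
  have hspace : ∀ i, stanleySpace (monomial (b i) (1 : K)) (Z i) =
      restrictSupport K ((⇑) ⁻¹' cone (a i) (Z i)) := fun i => stanleySpace_monomial _ _
  have hind : iSupIndep fun i => stanleySpace (monomial (b i) (1 : K)) (Z i) := by
    simp only [hspace]
    exact iSupIndep_restrictSupport _ fun i j hij => (hp hij).preimage _
  have hsup : ⨆ i, stanleySpace (monomial (b i) (1 : K)) (Z i) = J.restrictScalars K := by
    simp only [hspace]
    rw [iSup_restrictSupport, ← Set.preimage_iUnion]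
    ext f
    exact (hJ f).symm
  let D : StanleyDecomposition J :=
    { r := Nat.card ι
      u := fun i => monomial (b (σ.symm i)) 1
      Z := fun i => Z (σ.symm i)
      homogeneous := fun i => ⟨_, _, rfl⟩
      free := fun i v _ hv => (mul_eq_zero.1 hv).resolve_left
        (mt monomial_eq_zero.1 one_ne_zero)
      independent := hind.comp σ.symm.injective
      iSup_eq := (σ.symm.iSup_comp
        (g := fun i => stanleySpace (monomial (b i) (1 : K)) (Z i))).trans hsup }
  exact le_iSup_of_le D (le_iInf fun i => by exact_mod_cast hd _)

end Algebra

theorem corollary3p5 (K : Type*) [Field K] {V : Type*} [Finite V] (G : SimpleGraph V)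
    (hG : ∃ H : G.ConnectedComponent, H.toSimpleGraph.IsTree ∧ H.toSimpleGraph.edgeSet.Nonempty)
    (k : ℕ) (hk : 1 ≤ k) :
    ((numBipartiteComponents G + 1 : ℕ) : ℕ∞) ≤ sdepth (edgeIdeal K G ^ k) := by
  classical
  have := Fintype.ofFinite V
  exact le_sdepth_of_stanleyPartition (stanleyPartition_edgePow_univ hG k)
    (mem_edgeIdeal_pow G k)
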